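/- Let $\nu\in(0,1)$ and $h,\lambda,c>0$. Let $\{T_n:n\ge 1\}$ be i.i.d. random variables with the generalized Mittag-Leffler distribution, i.e. with density $$f_{\nu,h,\lambda}(t)=\lambda^h t^{\nu h-1}E_{\nu,\nu h}^h(-\lambda t^\nu)1_{(0,\infty)}(t),\qquad E_{\alpha,\beta}^\gamma(x)=\sum_{r\ge 0}\frac{(\gamma)_r\,x^r}{r!\,\Gamma(\alpha r+\beta)},$$ where $(\gamma)_0=1$ and $(\gamma)_r=\gamma(\gamma+1)\cdots(\gamma+r-1)$ for $r\ge 1$, and let $$M(t)=\sum_{n\ge 1}1_{\{T_1+\cdots+T_n\le t\}},\qquad t\ge 0,$$ be the associated (fractional Poisson) renewal counting process. Let $\{U_k:k\ge 1\}$ be i.i.d. positive random variables, independent of the process $\{M(t):t\ge 0\}$. For $u>0$ consider the reserve process and the ruin probability $$R(t)=u+ct-\sum_{k=1}^{M(t)}U_k,\qquad \Psi(u)=P(\exists\, t\ge 0:\ R(t)<0).$$ Define $\tilde\kappa_\nu:\mathbb{R}\to(-\infty,\infty]$ by $$\tilde\kappa_\nu(\theta)=\log\mathbb{E}[e^{\theta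 U_1}]+\log\mathbb{E}[e^{-c\theta T_1}],$$ and assume that $w>0$ belongs to the interior of $\{\theta\in\mathbb{R}:\tilde\kappa_\nu(\theta)<\infty\}$ and satisfies $\tilde\kappa_\nu(w)=0$. Then $$\lim_{u\to\infty}\frac1u\log\Psi(u)=-w.$$ -/

import Mathlib

open MeasureTheory ProbabilityTheory Filter Topology
open scoped NNReal ENNReal

namespace FractionalRisk

noncomputable section

/-- The generalized (three-parameter) Mittag-Leffler function
`E_{α,β}^γ(x) = ∑_{r ≥ 0} (γ)_r x^r / (r! Γ(α r + β))`, where `(γ)_r` is the rising factorial. -/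
def mittagLeffler (α β γ x : ℝ) : ℝ :=
  ∑' r : ℕ, (ascPochhammer ℝ r).eval γ * x ^ r / ((r.factorial : ℝ) * Real.Gamma (α * r + β))

/-- The generalized Mittag-Leffler density
`f_{ν,h,λ}(t) = λ^h t^{νh-1} E_{ν,νh}^h(-λ t^ν) 1_{(0,∞)}(t)`. -/
def mlDensity (ν h lam t : ℝ) : ℝ :=
  if 0 < t then
    lam ^ h * t ^ (ν * h - 1) * mittagLeffler ν (ν * h) h (-lam * t ^ ν)
  else 0

/-- The generalized Mittag-Leffler distribution, with density `f_{ν,h,λ}`. -/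
def mlLaw (ν h lam : ℝ) : Measure ℝ :=
  volume.withDensity (fun t => ENNReal.ofReal (mlDensity ν h lam t))

/-- The extended-valued cumulant generating function `θ ↦ log ∫ e^{θ x} P(dx)` of a law `P`. -/
def logMGF (P : Measure ℝ) (θ : ℝ) : EReal :=
  ENNReal.log (∫⁻ x, ENNReal.ofReal (Real.exp (θ * x)) ∂P)

/-- `κ̃_ν(θ) = log E[e^{θ U₁}] + κ_{ν,h,λ}(-cθ)`, where `P` is the law of the claim size `U₁` and
`κ_{ν,h,λ}(θ) = log E[e^{θ T₁}]` for `T₁` with law `mlLaw ν h lam`. If `P` is a probability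
measure, neither summand can be `-∞`. -/
def totalCumulant (ν h lam c : ℝ) (P : Measure ℝ) (θ : ℝ) : EReal :=
  logMGF P θ + logMGF (mlLaw ν h lam) (-(c * θ))

variable {Ω : Type*}

/-- The renewal counting process `M(t) = ∑_{n ≥ 1} 1_{T₁ + ⋯ + Tₙ ≤ t}`. Sequences are indexed
from `0`, so that `T n` is the `(n+1)`-st holding time. -/
def claimNumber (T : ℕ → Ω → ℝ) (t : ℝ≥0) (ω : Ω) : ℕ∞ :=
  ∑' n : ℕ, if ∑ k ∈ Finset.range (n + 1), T k ω ≤ (t : ℝ) then 1 else 0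

/-- The reserve process `R(t) = u + c t - ∑_{k=1}^{M(t)} U_k` (with `U k` the `(k+1)`-st claim).
For i.i.d. positive holding times, almost surely `M(t) < ∞` for all `t`; outside this event the
sum is by convention empty. -/
def reserve (c : ℝ) (T U : ℕ → Ω → ℝ) (u : ℝ) (t : ℝ≥0) (ω : Ω) : ℝ :=
  u + c * t - ∑ k ∈ Finset.range (claimNumber T t ω).toNat, U k ω

/-- The ruin probability `Ψ(u) = P(∃ t ≥ 0, R(t) < 0)`. -/
def ruinProb [MeasurableSpace Ω] (μ : Measure Ω) (c : ℝ) (T U : ℕ → Ω → ℝ) (u : ℝ) : ℝ :=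
  μ.real {ω | ∃ t : ℝ≥0, reserve c T U u t ω < 0}

end

end FractionalRisk

/-! Ruin, if it happens, happens at a claim arrival. So almost surely ruin means that the walk S_n =
∑ (U_k - c T_k) ever exceeds u, and w is a positive root of m(θ) = 1, where m is the mgf of one step
X = `S 1`.

Upper bound: just left of w one has m(θ) < 1, so Chernoff's inequality summed over n gives Ψ(u) ≤
e^{-θu} / (1 - m(θ)); then θ ↑ w. Lower bound: under the law tilted by e^{w S_n}, S_n / n
concentrates at a = E[X e^{wX}] > 0. Undoing the tilt gives P(S_n > nb) ≥ e^{-w n b'} / 2 for b < a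
< b' and n large; n ≈ u/b and b, b' → a give the rate -w.

About the law of S_n, both bounds use only E[e^{θ S_n}] = m(θ)^n. The Mittag-Leffler law enters only
through being positive and atomless; the latter makes X nondegenerate. -/

namespace FractionalRisk

/-! ### Level crossing of a random walk: Chernoff bounds and exponential tilting. -/

section RandomWalk

variable {Ω : Type*} [MeasurableSpace Ω] {μ : Measure Ω} {X : Ω → ℝ} {S : ℕ → Ω → ℝ} {w : ℝ}

/-- First-order comparison of a function with value `1` at `w` and an exponential. -/
theorem eventually_mul_sub_exp_neg {f : ℝ → ℝ} {a b : ℝ} (hf : HasDerivAt f a w) (hfw : f w = 1)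
    (hab : a < b) : ∀ᶠ s in 𝓝[≠] (0 : ℝ), (f (w + s) * Real.exp (-(s * b)) - 1) * s < 0 := by
  have hd : HasDerivAt (fun s ↦ f (w + s) * Real.exp (-(s * b))) (a - b) 0 := by
    have h1 : HasDerivAt (fun s ↦ f (w + s)) a 0 :=
      HasDerivAt.comp_const_add w 0 (by simpa using hf)
    have h2 : HasDerivAt (fun s : ℝ ↦ Real.exp (-(s * b))) (-b) 0 := by
      have := (((hasDerivAt_id (0 : ℝ)).mul_const b).neg).exp
      simpa using this
    refine (h1.fun_mul h2).congr_deriv ?_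
    simp [sub_eq_add_neg, hfw]
  have hs := (hasDerivAt_iff_tendsto_slope.1 hd).eventually_lt_const (sub_neg.2 hab)
  filter_upwards [hs, self_mem_nhdsWithin] with s hs hs0
  have hs0 : s ≠ 0 := hs0
  simp only [slope_def_field, add_zero, hfw, zero_mul, neg_zero, Real.exp_zero, mul_one,
    sub_zero] at hs
  have : 0 < s ^ 2 := by positivity
  calc _ = (f (w + s) * Real.exp (-(s * b)) - 1) / s * s ^ 2 := by field_simp
    _ < 0 := mul_neg_of_neg_of_pos hs this

/-- Chernoff bound for the measure with density `exp (w * Y)`. -/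
theorem setIntegral_exp_le {Y : Ω → ℝ} {s x : ℝ} {A : Set Ω} (hA : MeasurableSet A)
    (hint : Integrable (fun ω ↦ Real.exp (w * Y ω)) μ)
    (hint' : Integrable (fun ω ↦ Real.exp ((w + s) * Y ω)) μ)
    (h : ∀ ω ∈ A, 0 ≤ s * (Y ω - x)) :
    ∫ ω in A, Real.exp (w * Y ω) ∂μ ≤ Real.exp (-(s * x)) * mgf Y μ (w + s) := by
  calc ∫ ω in A, Real.exp (w * Y ω) ∂μ
      ≤ ∫ ω in A, Real.exp (-(s * x)) * Real.exp ((w + s) * Y ω) ∂μ := by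
        refine setIntegral_mono_on hint.integrableOn (hint'.const_mul _).integrableOn hA
          fun ω hω ↦ ?_
        rw [← Real.exp_add, Real.exp_le_exp]
        linarith [h ω hω]
    _ ≤ ∫ ω, Real.exp (-(s * x)) * Real.exp ((w + s) * Y ω) ∂μ :=
        setIntegral_le_integral (hint'.const_mul _) (ae_of_all _ fun ω ↦ by positivity)
    _ = _ := by rw [integral_const_mul, mgf]

variable [IsProbabilityMeasure μ]

/-- The exponentially tilted mean at a nonzero root of `mgf X μ = 1` is positive. -/
theorem integral_mul_exp_pos (hw0 : 0 < w) (hw : w ∈ interior (integrableExpSet X μ))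
    (hw1 : mgf X μ w = 1) (hX : ¬ X =ᵐ[μ] 0) : 0 < μ[fun ω ↦ X ω * Real.exp (w * X ω)] := by
  have hint : Integrable (fun ω ↦ X ω * Real.exp (w * X ω)) μ := by
    simpa using integrable_pow_mul_exp_of_mem_interior_integrableExpSet hw 1
  have hwm : w ∈ integrableExpSet X μ := interior_subset hw
  have hexp : Integrable (fun ω ↦ Real.exp (w * X ω)) μ := hwm
  -- By convexity of exp, `g ≥ 0`, strictly where `X ≠ 0`; since E[e^{wX} - 1] = 0, its integral is
  -- w E[X e^{wX}].
  set g : Ω → ℝ := fun ω ↦ w * (X ω * Real.exp (w * X ω)) - (Real.exp (w * X ω) - 1) with hg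
  have hgint : Integrable g μ := (hint.const_mul w).sub (hexp.sub (integrable_const 1))
  have key : ∀ ω, g ω = Real.exp (w * X ω) * (Real.exp (-(w * X ω)) - (-(w * X ω) + 1)) := by
    intro ω
    have : Real.exp (w * X ω) * Real.exp (-(w * X ω)) = 1 := by
      rw [← Real.exp_add, add_neg_cancel, Real.exp_zero]
    simp only [hg]
    linear_combination -this
  have hg0 : 0 ≤ g := fun ω ↦ by
    rw [key]
    exact mul_nonneg (Real.exp_pos _).le (sub_nonneg.2 (Real.add_one_le_exp _))
  have hgpos : 0 < ∫ ω, g ω ∂μ := by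
    refine lt_of_le_of_ne (integral_nonneg hg0) fun h0 ↦ hX ?_
    filter_upwards [(integral_eq_zero_iff_of_nonneg hg0 hgint).1 h0.symm] with ω hω
    by_contra hne
    have hne' : -(w * X ω) ≠ 0 := neg_ne_zero.2 (mul_ne_zero hw0.ne' hne)
    have := mul_pos (Real.exp_pos (w * X ω)) (sub_pos.2 (Real.add_one_lt_exp hne'))
    rw [← key, hω] at this
    exact lt_irrefl _ this
  have heq : ∫ ω, g ω ∂μ = w * μ[fun ω ↦ X ω * Real.exp (w * X ω)] := by
    have h1 : ∫ ω, Real.exp (w * X ω) ∂μ = 1 := hw1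
    have h2 : ∫ ω, (Real.exp (w * X ω) - 1) ∂μ = 0 := by
      rw [integral_sub hexp (integrable_const 1), h1]
      simp
    have h3 := integral_sub (hint.const_mul w) (hexp.sub (integrable_const 1))
    simp only [Pi.sub_apply] at h3
    rw [hg, h3, h2, sub_zero, integral_const_mul]
  rw [heq] at hgpos
  exact pos_of_mul_pos_right hgpos hw0.le

/-- `mgf (S n)` being the `n`-th power of `mgf X` transfers exponential integrability. -/
theorem integrable_exp_of_mgf_eq_pow
    (hmgf : ∀ n, ∀ θ ∈ integrableExpSet X μ, mgf (S n) μ θ = mgf X μ θ ^ n) (n : ℕ) {θ : ℝ}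
    (hθ : θ ∈ integrableExpSet X μ) : Integrable (fun ω ↦ Real.exp (θ * S n ω)) μ := by
  -- A non-integrable exponential would have mgf 0 by default, so positivity yields integrability.
  rw [← mgf_pos_iff, hmgf n θ hθ]
  exact pow_pos (mgf_pos hθ) n

/-- Union bound, with Chernoff's inequality at each `n`, summed as a geometric series. -/
theorem measureReal_exists_lt_le
    (hmgf : ∀ n, ∀ θ ∈ integrableExpSet X μ, mgf (S n) μ θ = mgf X μ θ ^ n) {θ : ℝ}
    (hθ0 : 0 ≤ θ) (hθ : θ ∈ integrableExpSet X μ) (hθ1 : mgf X μ θ < 1) (u : ℝ) :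
    μ.real {ω | ∃ n, u < S n ω} ≤ Real.exp (-(θ * u)) * (1 - mgf X μ θ)⁻¹ := by
  have hm0 : 0 ≤ mgf X μ θ := mgf_nonneg
  have hsum : HasSum (fun n : ℕ ↦ Real.exp (-(θ * u)) * mgf X μ θ ^ n)
      (Real.exp (-(θ * u)) * (1 - mgf X μ θ)⁻¹) :=
    (hasSum_geometric_of_lt_one hm0 hθ1).mul_left _
  have hpos : 0 < 1 - mgf X μ θ := sub_pos.2 hθ1
  refine ENNReal.toReal_le_of_le_ofReal (by positivity) ?_
  rw [← hsum.tsum_eq, ENNReal.ofReal_tsum_of_nonneg (fun n ↦ by positivity) hsum.summable]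
  calc μ {ω | ∃ n, u < S n ω} = μ (⋃ n, {ω | u < S n ω}) := by rw [Set.ofPred_exists]
    _ ≤ ∑' n, μ {ω | u < S n ω} := measure_iUnion_le _
    _ ≤ _ := by
      refine ENNReal.tsum_le_tsum fun n ↦ ?_
      rw [← ofReal_measureReal]
      refine ENNReal.ofReal_le_ofReal ?_
      have := measure_ge_le_exp_mul_mgf (μ := μ) u hθ0 (integrable_exp_of_mgf_eq_pow hmgf n hθ)
      rw [hmgf n θ hθ, neg_mul] at this
      exact (measureReal_mono fun ω (hω : u < S n ω) ↦ hω.le).trans this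

/-- Cramér's lower bound at the root of the moment generating function. -/
theorem eventually_le_measureReal_lt (hS : ∀ n, Measurable (S n))
    (hmgf : ∀ n, ∀ θ ∈ integrableExpSet X μ, mgf (S n) μ θ = mgf X μ θ ^ n)
    (hw0 : 0 < w) (hw : w ∈ interior (integrableExpSet X μ)) (hw1 : mgf X μ w = 1) {a b b' : ℝ}
    (ha : HasDerivAt (mgf X μ) a w) (hb : b < a) (hb' : a < b') :
    ∀ᶠ n : ℕ in atTop, Real.exp (-(w * (n * b'))) / 2 ≤ μ.real {ω | n * b < S n ω} := by
  have hnear : ∀ᶠ s in 𝓝 (0 : ℝ), w + s ∈ integrableExpSet X μ := by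
    have : Tendsto (fun s : ℝ ↦ w + s) (𝓝 0) (𝓝 w) := by
      have hc : Continuous fun s : ℝ ↦ w + s := by fun_prop
      simpa using hc.tendsto 0
    exact this (mem_interior_iff_mem_nhds.1 hw)
  -- `s > 0` and, below, `t < 0` are Chernoff parameters for the two tails of the tilted law; the
  -- rates are below 1 because b < a < b'.
  obtain ⟨s, hs0, hs, hsw⟩ : ∃ s : ℝ, 0 < s ∧ mgf X μ (w + s) * Real.exp (-(s * b')) < 1 ∧
      w + s ∈ integrableExpSet X μ := by
    have h1 := (eventually_mul_sub_exp_neg ha hw1 hb').filter_mono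
      (nhdsWithin_mono 0 fun s (hs : s ∈ Set.Ioi 0) ↦ (Set.mem_Ioi.1 hs).ne')
    obtain ⟨s, h1, h2, hs⟩ :=
      (h1.and ((hnear.filter_mono nhdsWithin_le_nhds).and self_mem_nhdsWithin)).exists
    have hs : 0 < s := hs
    exact ⟨s, hs, by nlinarith, h2⟩
  obtain ⟨t, ht0, ht, htw⟩ : ∃ t : ℝ, t < 0 ∧ mgf X μ (w + t) * Real.exp (-(t * b)) < 1 ∧
      w + t ∈ integrableExpSet X μ := by
    -- Reflection reduces the left tail to the same first-order comparison, with slope -a < -b.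
    have hneg : HasDerivAt (fun x ↦ mgf X μ (-x)) (-a) (-w) := by
      have : HasDerivAt (mgf X μ) a (- -w) := by rwa [neg_neg]
      have := this.comp (-w) (hasDerivAt_neg (-w))
      rwa [mul_neg_one] at this
    have h1 := (eventually_mul_sub_exp_neg hneg (by simpa using hw1) (neg_lt_neg hb)).filter_mono
      (nhdsWithin_mono 0 fun s (hs : s ∈ Set.Ioi 0) ↦ (Set.mem_Ioi.1 hs).ne')
    have hnear' : ∀ᶠ s in 𝓝 (0 : ℝ), w + -s ∈ integrableExpSet X μ :=
      (by simpa using (continuous_neg (G := ℝ)).tendsto 0 :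
        Tendsto (fun s : ℝ ↦ -s) (𝓝 0) (𝓝 0)).eventually hnear
    obtain ⟨s, h1, h2, hs⟩ :=
      (h1.and ((hnear'.filter_mono nhdsWithin_le_nhds).and self_mem_nhdsWithin)).exists
    have hs : 0 < s := hs
    refine ⟨-s, by linarith, ?_, h2⟩
    rw [neg_add, neg_neg] at h1
    have : -(-s * b) = -(s * -b) := by ring
    rw [this]
    nlinarith
  set r := mgf X μ (w + s) * Real.exp (-(s * b')) with hr
  set q := mgf X μ (w + t) * Real.exp (-(t * b)) with hq
  have hr0 : 0 ≤ r := mul_nonneg mgf_nonneg (Real.exp_pos _).le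
  have hq0 : 0 ≤ q := mul_nonneg mgf_nonneg (Real.exp_pos _).le
  have hlim : Tendsto (fun n : ℕ ↦ r ^ n + q ^ n) atTop (𝓝 0) := by
    simpa using (tendsto_pow_atTop_nhds_zero_of_lt_one hr0 hs).add
      (tendsto_pow_atTop_nhds_zero_of_lt_one hq0 ht)
  filter_upwards [hlim.eventually_le_const (by norm_num : (0 : ℝ) < 1 / 2)] with n hn
  have hwm : w ∈ integrableExpSet X μ := interior_subset hw
  have hint := integrable_exp_of_mgf_eq_pow hmgf n hwm
  set A : Set Ω := {ω | n * b' ≤ S n ω}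
  set B : Set Ω := {ω | S n ω ≤ n * b}
  set D : Set Ω := Aᶜ ∩ Bᶜ
  have hA : MeasurableSet A := measurableSet_le measurable_const (hS n)
  have hB : MeasurableSet B := measurableSet_le (hS n) measurable_const
  have hD : MeasurableSet D := hA.compl.inter hB.compl
  have hAi : ∫ ω in A, Real.exp (w * S n ω) ∂μ ≤ r ^ n := by
    refine (setIntegral_exp_le (s := s) (x := n * b') hA hint
      (integrable_exp_of_mgf_eq_pow hmgf n hsw)
      fun ω hω ↦ mul_nonneg hs0.le (sub_nonneg.2 hω)).trans_eq ?_
    rw [hmgf n _ hsw, hr, mul_pow, ← Real.exp_nat_mul, mul_comm]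
    congr 2
    ring
  have hBi : ∫ ω in B, Real.exp (w * S n ω) ∂μ ≤ q ^ n := by
    refine (setIntegral_exp_le (s := t) (x := n * b) hB hint
      (integrable_exp_of_mgf_eq_pow hmgf n htw)
      fun ω hω ↦ mul_nonneg_of_nonpos_of_nonpos ht0.le (sub_nonpos.2 hω)).trans_eq ?_
    rw [hmgf n _ htw, hq, mul_pow, ← Real.exp_nat_mul, mul_comm]
    congr 2
    ring
  -- On `D` the tilting density is at most e^{w n b'}, while `A` and `B` together carry tilted mass
  -- at most r^n + q^n ≤ 1/2.
  have hDi : ∫ ω in D, Real.exp (w * S n ω) ∂μ ≤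
      Real.exp (w * (n * b')) * μ.real {ω | n * b < S n ω} := by
    calc ∫ ω in D, Real.exp (w * S n ω) ∂μ ≤ ∫ ω in D, Real.exp (w * (n * b')) ∂μ := by
          refine setIntegral_mono_on hint.integrableOn (integrable_const _).integrableOn hD
            fun ω hω ↦ ?_
          have : S n ω < n * b' := not_le.1 hω.1
          rw [Real.exp_le_exp]
          gcongr
      _ = Real.exp (w * (n * b')) * μ.real D := by
          rw [setIntegral_const, smul_eq_mul, mul_comm]
      _ ≤ _ := by
          have hsub : D ⊆ {ω | n * b < S n ω} := fun ω hω ↦ not_le.1 (show ¬ S n ω ≤ n * b from hω.2)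
          exact mul_le_mul_of_nonneg_left (measureReal_mono hsub) (Real.exp_pos _).le
  have htot : 1 ≤ ∫ ω in A, Real.exp (w * S n ω) ∂μ + ∫ ω in B, Real.exp (w * S n ω) ∂μ +
      ∫ ω in D, Real.exp (w * S n ω) ∂μ := by
    have h1 : ∫ ω, Real.exp (w * S n ω) ∂μ = 1 := by
      have := hmgf n w hwm
      rwa [hw1, one_pow] at this
    have h2 := integral_add_compl hA hint
    have h3 := integral_inter_add_sdiff (s := Aᶜ) hB hint.integrableOn
    have h4 : ∫ ω in Aᶜ ∩ B, Real.exp (w * S n ω) ∂μ ≤ ∫ ω in B, Real.exp (w * S n ω) ∂μ :=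
      setIntegral_mono_set hint.integrableOn (ae_of_all _ fun ω ↦ (Real.exp_pos _).le)
        (Set.inter_subset_right.eventuallyLE)
    rw [Set.sdiff_eq] at h3
    linarith
  have hfin : 1 / 2 ≤ Real.exp (w * (n * b')) * μ.real {ω | n * b < S n ω} := by linarith
  rw [Real.exp_neg, div_le_iff₀ two_pos, inv_le_iff_one_le_mul₀ (Real.exp_pos _)]
  linarith

/-- Logarithmic asymptotics of the probability that a random walk ever exceeds a high level. -/
theorem tendsto_log_measureReal_exists_lt (hS : ∀ n, Measurable (S n))
    (hmgf : ∀ n, ∀ θ ∈ integrableExpSet X μ, mgf (S n) μ θ = mgf X μ θ ^ n)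
    (hw0 : 0 < w) (hw : w ∈ interior (integrableExpSet X μ)) (hw1 : mgf X μ w = 1)
    (hX : ¬ X =ᵐ[μ] 0) :
    Tendsto (fun u : ℝ ↦ 1 / u * Real.log (μ.real {ω | ∃ n, u < S n ω})) atTop (𝓝 (-w)) := by
  have hderiv := hasDerivAt_mgf hw
  have hapos := integral_mul_exp_pos hw0 hw hw1 hX
  set a := μ[fun ω ↦ X ω * Real.exp (w * X ω)]
  have hlow : ∀ b b' : ℝ, 0 < b → b < a → a < b' → ∀ᶠ u : ℝ in atTop,
      Real.exp (-(w * ((u / b + 1) * b'))) / 2 ≤ μ.real {ω | ∃ n, u < S n ω} := by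
    intro b b' hb0 hb hb'
    have hev := eventually_le_measureReal_lt hS hmgf hw0 hw hw1 hderiv hb hb'
    -- The `+ 1` makes n b > u strict.
    have hfl : Tendsto (fun u : ℝ ↦ ⌊u / b⌋₊ + 1) atTop atTop :=
      (tendsto_add_atTop_nat 1).comp
        (tendsto_nat_floor_atTop.comp (tendsto_id.atTop_div_const hb0))
    filter_upwards [hfl.eventually hev, eventually_ge_atTop 0] with u hu hu0
    have h1 : u < ((⌊u / b⌋₊ + 1 : ℕ) : ℝ) * b := by
      rw [← div_lt_iff₀ hb0]
      exact_mod_cast Nat.lt_floor_add_one (u / b)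
    have h2 : ((⌊u / b⌋₊ + 1 : ℕ) : ℝ) ≤ u / b + 1 := by
      push_cast
      gcongr
      exact Nat.floor_le (by positivity)
    have hb'0 : 0 < b' := hapos.trans hb'
    calc Real.exp (-(w * ((u / b + 1) * b'))) / 2
        ≤ Real.exp (-(w * (((⌊u / b⌋₊ + 1 : ℕ) : ℝ) * b'))) / 2 := by gcongr
      _ ≤ _ := hu
      _ ≤ μ.real {ω | ∃ n, u < S n ω} := by
          refine measureReal_mono fun ω hω ↦ ?_
          exact ⟨⌊u / b⌋₊ + 1, h1.trans hω⟩
  rw [tendsto_order]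
  constructor
  · intro z hz
    obtain ⟨b, b', hb0, hb, hb', hz'⟩ : ∃ b b' : ℝ, 0 < b ∧ b < a ∧ a < b' ∧
        z < -(w * (b' / b)) := by
      have hc : ContinuousAt (fun e : ℝ ↦ -(w * ((a + e) / (a - e)))) 0 := by
        have : a - 0 ≠ 0 := by simpa using hapos.ne'
        fun_prop (disch := assumption)
      have h0 : z < -(w * ((a + 0) / (a - 0))) := by
        simpa [hapos.ne'] using hz
      have h1 : ∀ᶠ e : ℝ in 𝓝[>] 0, z < -(w * ((a + e) / (a - e))) :=
        (hc.eventually_const_lt h0).filter_mono nhdsWithin_le_nhds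
      have h2 : ∀ᶠ e : ℝ in 𝓝[>] 0, e < a :=
        (eventually_lt_nhds hapos).filter_mono nhdsWithin_le_nhds
      obtain ⟨e, h1, h2, he⟩ := (h1.and (h2.and self_mem_nhdsWithin)).exists
      have he : 0 < e := he
      exact ⟨a - e, a + e, by linarith, by linarith, by linarith, h1⟩
    have hlim : Tendsto (fun u : ℝ ↦ -(w * (b' / b)) - (w * b' + Real.log 2) / u) atTop
        (𝓝 (-(w * (b' / b)))) := by
      simpa using (tendsto_const_nhds (x := -(w * (b' / b)))).sub
        ((tendsto_const_nhds (x := w * b' + Real.log 2)).div_atTop tendsto_id)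
    filter_upwards [hlow b b' hb0 hb hb', eventually_gt_atTop 0, hlim.eventually_const_lt hz']
      with u hu hu0 hzu
    refine hzu.trans_le ?_
    have hlog := Real.log_le_log (by positivity) hu
    rw [Real.log_div (Real.exp_pos _).ne' two_ne_zero, Real.log_exp] at hlog
    calc -(w * (b' / b)) - (w * b' + Real.log 2) / u
        = 1 / u * (-(w * ((u / b + 1) * b')) - Real.log 2) := by
          field_simp
          ring
      _ ≤ _ := by gcongr
  · intro z hz
    -- The mgf is 1 at `w` with derivative a > 0, hence below 1 just to the left.
    obtain ⟨θ, hθ0, hθz, hθ, hθ1⟩ : ∃ θ : ℝ, 0 ≤ θ ∧ -θ < z ∧ θ ∈ integrableExpSet X μ ∧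
        mgf X μ θ < 1 := by
      have hslope := (hasDerivAt_iff_tendsto_slope.1 hderiv).eventually_const_lt hapos
      have h1 := hslope.filter_mono (nhdsWithin_mono w fun s (hs : s ∈ Set.Iio w) ↦ (Set.mem_Iio.1 hs).ne)
      have h2 : ∀ᶠ θ in 𝓝[<] w, θ ∈ integrableExpSet X μ ∧ 0 < θ ∧ -z < θ :=
        (Eventually.and (mem_interior_iff_mem_nhds.1 hw)
          ((eventually_gt_nhds hw0).and (eventually_gt_nhds (by linarith)))).filter_mono
          nhdsWithin_le_nhds
      obtain ⟨θ, h1, ⟨h2, h3, h4⟩, h5⟩ := (h1.and (h2.and self_mem_nhdsWithin)).exists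
      have h5 : θ < w := h5
      refine ⟨θ, h3.le, by linarith, h2, ?_⟩
      rw [slope_def_field, hw1] at h1
      by_contra! hcon
      exact absurd (div_nonpos_of_nonneg_of_nonpos (sub_nonneg.2 hcon) (sub_nonpos.2 h5.le))
        (not_le.2 h1)
    have hpos : 0 < 1 - mgf X μ θ := sub_pos.2 hθ1
    have hlim : Tendsto (fun u : ℝ ↦ -θ + Real.log (1 - mgf X μ θ)⁻¹ / u) atTop (𝓝 (-θ)) := by
      simpa using (tendsto_const_nhds (x := -θ)).add
        ((tendsto_const_nhds (x := Real.log (1 - mgf X μ θ)⁻¹)).div_atTop tendsto_id)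
    -- The lower bound serves here only to make the probability positive, so that logarithms can be
    -- compared.
    filter_upwards [hlow (a / 2) (a + 1) (by linarith) (by linarith) (by linarith),
      eventually_gt_atTop 0, hlim.eventually_lt_const hθz] with u hu hu0 hzu
    refine lt_of_le_of_lt ?_ hzu
    have hlog := Real.log_le_log (lt_of_lt_of_le (by positivity) hu)
      (measureReal_exists_lt_le hmgf hθ0 hθ hθ1 u)
    rw [Real.log_mul (Real.exp_pos _).ne' (inv_pos.2 hpos).ne', Real.log_exp] at hlog
    calc _ ≤ 1 / u * (-(θ * u) + Real.log (1 - mgf X μ θ)⁻¹) := by gcongr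
      _ = _ := by field_simp

end RandomWalk

/-! ### The counting process, its arrival times, and ruin at arrivals. -/

section ClaimNumber

variable {Ω : Type*} {T U : ℕ → Ω → ℝ} {ω : Ω}

/-- The partial sums increase, so the nonzero indicators form an initial segment. -/
theorem natCast_le_claimNumber_iff (hT : ∀ k, 0 < T k ω) (n : ℕ) (t : ℝ≥0) :
    (n : ℕ∞) ≤ claimNumber T t ω ↔ ∑ k ∈ Finset.range n, T k ω ≤ t := by
  have hmono : Monotone fun n ↦ ∑ k ∈ Finset.range n, T k ω :=
    monotone_nat_of_le_succ fun n ↦ by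
      rw [Finset.sum_range_succ]
      exact le_add_of_nonneg_right (hT n).le
  constructor
  · intro h
    by_contra! hlt
    obtain _ | m := n
    · simp only [Finset.range_zero, Finset.sum_empty] at hlt
      exact absurd t.2 (not_le.2 hlt)
    have hle : claimNumber T t ω ≤ m := by
      rw [claimNumber, tsum_eq_sum (s := Finset.range m)]
      · refine (Finset.sum_le_card_nsmul _ _ 1 fun i _ ↦ ?_).trans (by simp)
        split_ifs <;> simp
      · intro i hi
        rw [if_neg]
        rw [Finset.mem_range, not_lt] at hi
        exact not_le.2 (hlt.trans_le (hmono (Nat.succ_le_succ hi)))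
    have := h.trans hle
    rw [Nat.cast_le] at this
    omega
  · intro h
    calc (n : ℕ∞) = ∑ i ∈ Finset.range n,
          if ∑ k ∈ Finset.range (i + 1), T k ω ≤ (t : ℝ) then (1 : ℕ∞) else 0 := by
          rw [Finset.sum_congr rfl fun i hi ↦
            if_pos ((hmono (Nat.succ_le_of_lt (Finset.mem_range.1 hi))).trans h)]
          simp
      _ ≤ _ := (hasSum_of_isLUB _ isLUB_iSup).summable.sum_le_tsum _
          (fun _ _ ↦ zero_le)

theorem exists_reserve_neg_iff {c u : ℝ} (hc : 0 < c) (hT : ∀ k, 0 < T k ω) :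
    (∃ t : ℝ≥0, reserve c T U u t ω < 0) ↔
      ∃ n : ℕ, u < ∑ k ∈ Finset.range n, U k ω - c * ∑ k ∈ Finset.range n, T k ω := by
  constructor
  · rintro ⟨t, ht⟩
    rw [reserve] at ht
    have hct : 0 ≤ c * t := mul_nonneg hc.le t.2
    -- `toNat` sends `⊤` to 0, so no finiteness of the claim number is needed.
    have hle : ∑ k ∈ Finset.range (claimNumber T t ω).toNat, T k ω ≤ t :=
      (natCast_le_claimNumber_iff hT _ t).1 (ENat.natCast_toNat_le_self _)
    refine ⟨(claimNumber T t ω).toNat, ?_⟩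
    have := mul_le_mul_of_nonneg_left hle hc.le
    linarith
  · rintro ⟨n, hn⟩
    refine ⟨⟨∑ k ∈ Finset.range n, T k ω, Finset.sum_nonneg fun k _ ↦ (hT k).le⟩, ?_⟩
    set t : ℝ≥0 := ⟨∑ k ∈ Finset.range n, T k ω, Finset.sum_nonneg fun k _ ↦ (hT k).le⟩
    have hclaim : claimNumber T t ω = n := by
      refine le_antisymm ?_ ((natCast_le_claimNumber_iff hT n t).2 le_rfl)
      by_contra! hlt
      have h1 := (natCast_le_claimNumber_iff hT (n + 1) t).1 (by
        push_cast
        exact Order.add_one_le_of_lt hlt)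
      rw [Finset.sum_range_succ] at h1
      exact absurd h1 (not_le.2 (lt_add_of_pos_right _ (hT n)))
    rw [reserve, hclaim, ENat.toNat_natCast]
    change u + c * ∑ k ∈ Finset.range n, T k ω - _ < 0
    linarith

/-- The arrival time of the `n`-th claim, read off from the path of the counting process. -/
noncomputable def arrivalTime (n : ℕ) (m : ℝ≥0 → ℕ∞) : ℝ :=
  (⨅ q : ℚ, if (n : ℕ∞) ≤ m (Real.toNNReal q) then (Real.toNNReal q : ℝ≥0∞) else ⊤).toReal

/-- Only rational times enter, so the infimum is countable and measurable for the product σ-algebra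
on paths. -/
theorem measurable_arrivalTime (n : ℕ) : Measurable (arrivalTime n) := by
  refine Measurable.ennreal_toReal
    (Measurable.iInf fun q ↦ Measurable.ite ?_ measurable_const measurable_const)
  have hIci : MeasurableSet (Set.Ici (n : ℕ∞)) := MeasurableSet.of_discrete
  exact measurable_pi_apply (X := fun _ : ℝ≥0 ↦ ℕ∞) (Real.toNNReal q) hIci

theorem arrivalTime_claimNumber (hT : ∀ k, 0 < T k ω) (n : ℕ) :
    arrivalTime n (fun t ↦ claimNumber T t ω) = ∑ k ∈ Finset.range n, T k ω := by
  obtain ⟨x, hx⟩ : ∃ x : ℝ≥0, (x : ℝ) = ∑ k ∈ Finset.range n, T k ω :=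
    ⟨⟨∑ k ∈ Finset.range n, T k ω, Finset.sum_nonneg fun k _ ↦ (hT k).le⟩, rfl⟩
  have h : (⨅ q : ℚ, if (n : ℕ∞) ≤ claimNumber T (Real.toNNReal q) ω
      then (Real.toNNReal q : ℝ≥0∞) else ⊤) = x := by
    simp only [natCast_le_claimNumber_iff hT, ← hx, NNReal.coe_le_coe]
    refine le_antisymm (le_of_forall_gt fun y hy ↦ ?_) (le_iInf fun q ↦ ?_)
    · obtain ⟨q, -, hxq, hqy⟩ := ENNReal.lt_iff_exists_rat_btwn.1 hy
      refine (iInf_le _ q).trans_lt ?_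
      rwa [if_pos (ENNReal.coe_lt_coe.1 hxq).le]
    · split_ifs with h
      · exact ENNReal.coe_le_coe.2 h
      · exact le_top
  rw [arrivalTime, h, ENNReal.coe_toReal, hx]

/-- Independence is given for the counting process, not the holding times; it passes to arrival
times as measurable functions of the path. -/
theorem indepFun_sum_of_indepFun_claimNumber [MeasurableSpace Ω] {μ : Measure Ω}
    (hT : ∀ᵐ ω ∂μ, ∀ k, 0 < T k ω)
    (hUM : IndepFun (fun ω k => U k ω) (fun ω t => claimNumber T t ω) μ) (n : ℕ) :
    IndepFun (∑ k ∈ Finset.range n, U k) (∑ k ∈ Finset.range n, T k) μ := by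
  have hsum : Measurable fun x : ℕ → ℝ ↦ ∑ k ∈ Finset.range n, x k :=
    Finset.measurable_sum _ fun k _ ↦ measurable_pi_apply k
  refine (hUM.comp hsum (measurable_arrivalTime n)).congr ?_ ?_
  · exact ae_of_all _ fun ω ↦ by simp
  · filter_upwards [hT] with ω hω
    simpa using arrivalTime_claimNumber hω n

end ClaimNumber

/-! ### Exponential moments and absence of atoms. -/

section Law

theorem lintegral_exp_ne_zero (P : Measure ℝ) [IsProbabilityMeasure P] (θ : ℝ) :
    ∫⁻ x, ENNReal.ofReal (Real.exp (θ * x)) ∂P ≠ 0 := by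
  rw [Ne, lintegral_eq_zero_iff (by fun_prop)]
  intro h
  have : ∀ᵐ _ ∂P, False := by
    filter_upwards [h] with x hx
    exact absurd hx (ENNReal.ofReal_pos.2 (Real.exp_pos _)).ne'
  exact this.exists.elim fun _ ↦ id

theorem toReal_lintegral_exp {Ω : Type*} [MeasurableSpace Ω] {μ : Measure Ω} {Y : Ω → ℝ}
    (hY : Measurable Y) (θ : ℝ) :
    (∫⁻ x, ENNReal.ofReal (Real.exp (θ * x)) ∂(μ.map Y)).toReal = mgf Y μ θ := by
  rw [← mgf_id_map hY.aemeasurable, mgf, integral_eq_lintegral_of_nonneg_ae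
    (ae_of_all _ fun x ↦ (Real.exp_pos _).le) (by fun_prop)]
  rfl

/-- No finiteness is needed: 0 * ∞ = 0 matches ⊥ + ⊤ = ⊥. -/
theorem totalCumulant_eq_log_mul (ν h lam c : ℝ) (P : Measure ℝ) (θ : ℝ) :
    totalCumulant ν h lam c P θ =
      ENNReal.log ((∫⁻ x, ENNReal.ofReal (Real.exp (θ * x)) ∂P) *
        ∫⁻ x, ENNReal.ofReal (Real.exp (-(c * θ) * x)) ∂(mlLaw ν h lam)) := by
  rw [ENNReal.log_mul_add]
  rfl

instance (ν h lam : ℝ) : NullSingletonClass (mlLaw ν h lam) := by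
  rw [mlLaw]
  infer_instance

theorem ae_pos_mlLaw (ν h lam : ℝ) : ∀ᵐ t ∂(mlLaw ν h lam), 0 < t := by
  have hset : MeasurableSet {t : ℝ | ¬ 0 < t} := measurableSet_Ioi.compl
  rw [ae_iff, mlLaw, withDensity_apply _ hset]
  refine (setLIntegral_congr_fun (g := 0) hset fun t ht ↦ ?_).trans (by simp)
  have ht : ¬ 0 < t := ht
  simp [mlDensity, ht]

end Law

/-- Independent variables with values in `ℝ`, one of them without atoms, almost surely differ. -/
theorem not_ae_eq_of_indepFun {Ω : Type*} [MeasurableSpace Ω] {μ : Measure Ω}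
    [IsProbabilityMeasure μ] {Y Z : Ω → ℝ} (hY : Measurable Y) (hZ : Measurable Z)
    (hYZ : IndepFun Y Z μ) [NullSingletonClass (μ.map Z)] {c : ℝ} (hc : c ≠ 0) :
    ¬ ∀ᵐ ω ∂μ, Y ω = c * Z ω := by
  intro h
  have hprod := (indepFun_iff_map_prod_eq_prod_map_map hY.aemeasurable hZ.aemeasurable).1 hYZ
  have := Measure.isProbabilityMeasure_map (μ := μ) hZ.aemeasurable
  have hset : MeasurableSet {p : ℝ × ℝ | p.1 = c * p.2} :=
    measurableSet_eq_fun (by fun_prop) (by fun_prop)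
  have h0 : μ.map (fun ω ↦ (Y ω, Z ω)) {p : ℝ × ℝ | p.1 = c * p.2} = 0 := by
    -- Fubini: each section is the single point y / c, null for the law of `Z`.
    rw [hprod, Measure.measure_prod_null hset]
    refine ae_of_all _ fun y ↦ ?_
    have : Prod.mk y ⁻¹' {p : ℝ × ℝ | p.1 = c * p.2} = {y / c} := by
      ext z
      simp only [Set.mem_preimage, Set.mem_ofPred_eq, Set.mem_singleton_iff]
      rw [eq_div_iff hc, mul_comm z c, eq_comm]
    simp only [this, measure_singleton, Pi.zero_apply]
  rw [Measure.map_apply (hY.prodMk hZ) hset] at h0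
  have : ∀ᵐ ω ∂μ, False := by
    filter_upwards [h, measure_eq_zero_iff_ae_notMem.1 h0] with ω h1 h2
    exact h2 h1
  exact this.exists.elim fun _ ↦ id

theorem mgf_sum_range_of_map_eq {Ω : Type*} [MeasurableSpace Ω] {μ : Measure Ω}
    {Y : ℕ → Ω → ℝ} (hY : ∀ n, Measurable (Y n)) (hindep : iIndepFun Y μ)
    (hident : ∀ n, μ.map (Y n) = μ.map (Y 0)) (n : ℕ) (θ : ℝ) :
    mgf (∑ k ∈ Finset.range n, Y k) μ θ = mgf (Y 0) μ θ ^ n := by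
  rw [hindep.mgf_sum hY, Finset.prod_congr rfl fun k _ ↦ ?_, Finset.prod_const, Finset.card_range]
  rw [← mgf_id_map (hY k).aemeasurable, hident, mgf_id_map (hY 0).aemeasurable]

end FractionalRisk

/-! ### The ruin probability as a crossing probability. -/

theorem mainTheorem3 {Ω : Type*} [MeasurableSpace Ω] (μ : Measure Ω) [IsProbabilityMeasure μ]
    (ν h lam c : ℝ) (hν0 : 0 < ν) (hν1 : ν < 1) (hh : 0 < h) (hlam : 0 < lam) (hc : 0 < c)
    (T U : ℕ → Ω → ℝ)
    -- the holding times are i.i.d. with the generalized Mittag-Leffler distribution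
    (hTmeas : ∀ n, Measurable (T n))
    (hTindep : iIndepFun T μ)
    (hTlaw : ∀ n, μ.map (T n) = FractionalRisk.mlLaw ν h lam)
    -- the claim sizes are i.i.d. and positive
    (hUmeas : ∀ k, Measurable (U k))
    (hUindep : iIndepFun U μ)
    (hUident : ∀ k, μ.map (U k) = μ.map (U 0))
    (hUpos : ∀ k, ∀ᵐ ω ∂μ, 0 < U k ω)
    -- the sequence of claim sizes is independent of the claim number process
    (hUM : IndepFun (fun ω k => U k ω) (fun ω t => FractionalRisk.claimNumber T t ω) μ)
    -- the root `w`
    (w : ℝ) (hw0 : 0 < w)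
    (hwdom : w ∈ interior {θ : ℝ | FractionalRisk.totalCumulant ν h lam c (μ.map (U 0)) θ < ⊤})
    (hw : FractionalRisk.totalCumulant ν h lam c (μ.map (U 0)) w = 0) :
    Tendsto (fun u : ℝ => 1 / u * Real.log (FractionalRisk.ruinProb μ c T U u)) atTop
      (𝓝 (-w)) := by
  have hTpos : ∀ᵐ ω ∂μ, ∀ k, 0 < T k ω := by
    refine ae_all_iff.2 fun k ↦ ae_of_ae_map (hTmeas k).aemeasurable ?_
    rw [hTlaw]
    exact FractionalRisk.ae_pos_mlLaw ν h lam
  have hUprob := Measure.isProbabilityMeasure_map (μ := μ) (hUmeas 0).aemeasurable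
  have hTprob := Measure.isProbabilityMeasure_map (μ := μ) (hTmeas 0).aemeasurable
  have hatoms : NullSingletonClass (μ.map (T 0)) := by
    rw [hTlaw]
    infer_instance
  have hTident : ∀ n, μ.map (T n) = μ.map (T 0) := fun n ↦ by rw [hTlaw, hTlaw]
  have hindep := FractionalRisk.indepFun_sum_of_indepFun_claimNumber hTpos hUM
  set S : ℕ → Ω → ℝ := fun n ω ↦
    ∑ k ∈ Finset.range n, U k ω - c * ∑ k ∈ Finset.range n, T k ω with hS
  have hSmeas : ∀ n, Measurable (S n) := fun n ↦ by fun_prop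
  have hSmgf : ∀ n θ, mgf (S n) μ θ = (mgf (U 0) μ θ * mgf (T 0) μ (-(c * θ))) ^ n := by
    intro n θ
    have hSn : S n = (∑ k ∈ Finset.range n, U k) +
        fun ω ↦ -c * (∑ k ∈ Finset.range n, T k) ω := by
      ext ω
      simp [hS, sub_eq_add_neg]
    have hind : IndepFun (∑ k ∈ Finset.range n, U k)
        (fun ω ↦ -c * (∑ k ∈ Finset.range n, T k) ω) μ :=
      (hindep n).comp measurable_id (measurable_const_mul (-c))
    rw [hSn, hind.mgf_add' (by fun_prop) (by fun_prop), mul_pow, ← neg_mul,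
      ← FractionalRisk.mgf_sum_range_of_map_eq hUmeas hUindep hUident,
      ← FractionalRisk.mgf_sum_range_of_map_eq hTmeas hTindep hTident, ← mgf_const_mul]
  have hcum : ∀ θ, FractionalRisk.totalCumulant ν h lam c (μ.map (U 0)) θ =
      ENNReal.log ((∫⁻ x, ENNReal.ofReal (Real.exp (θ * x)) ∂(μ.map (U 0))) *
        ∫⁻ x, ENNReal.ofReal (Real.exp (-(c * θ) * x)) ∂(μ.map (T 0))) := fun θ ↦ by
    rw [hTlaw, FractionalRisk.totalCumulant_eq_log_mul]
  have hS1 : ∀ θ, mgf (S 1) μ θ =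
      ((∫⁻ x, ENNReal.ofReal (Real.exp (θ * x)) ∂(μ.map (U 0))) *
        ∫⁻ x, ENNReal.ofReal (Real.exp (-(c * θ) * x)) ∂(μ.map (T 0))).toReal := fun θ ↦ by
    rw [ENNReal.toReal_mul, FractionalRisk.toReal_lintegral_exp (hUmeas 0),
      FractionalRisk.toReal_lintegral_exp (hTmeas 0), hSmgf, pow_one]
  -- Both exponential integrals are nonzero, so a finite product makes the mgf of `S 1` positive,
  -- which forces integrability.
  have hsub : {θ : ℝ | FractionalRisk.totalCumulant ν h lam c (μ.map (U 0)) θ < ⊤} ⊆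
      integrableExpSet (S 1) μ := by
    intro θ (hθ : FractionalRisk.totalCumulant ν h lam c (μ.map (U 0)) θ < ⊤)
    rw [hcum, lt_top_iff_ne_top, Ne, ENNReal.log_eq_top_iff] at hθ
    have : 0 < mgf (S 1) μ θ := by
      rw [hS1]
      exact ENNReal.toReal_pos (mul_ne_zero (FractionalRisk.lintegral_exp_ne_zero _ _)
        (FractionalRisk.lintegral_exp_ne_zero _ _)) hθ
    exact mgf_pos_iff.1 this
  have hw1 : mgf (S 1) μ w = 1 := by
    rw [hcum, ENNReal.log_eq_one_iff] at hw
    rw [hS1, hw, ENNReal.toReal_one]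
  have hX : ¬ S 1 =ᵐ[μ] 0 := by
    intro h0
    have h1 := hindep 1
    simp only [Finset.range_one, Finset.sum_singleton] at h1
    refine FractionalRisk.not_ae_eq_of_indepFun (hUmeas 0) (hTmeas 0) h1 hc.ne' ?_
    filter_upwards [h0] with ω hω
    simpa [hS, sub_eq_zero] using hω
  refine (FractionalRisk.tendsto_log_measureReal_exists_lt hSmeas
    (fun n θ _ ↦ by rw [hSmgf, hSmgf 1, pow_one]) hw0 (interior_mono hsub hwdom) hw1 hX).congr fun u ↦ ?_
  congr 2
  refine (measureReal_congr ?_).symm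
  filter_upwards [hTpos] with ω hω
  exact propext (FractionalRisk.exists_reserve_neg_iff hc hω)
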